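/- For each $n\ge 1$ let $Q_n$ be the number of cycles (fixed points counted as cycles of length one) of a uniformly random permutation in the symmetric group $S_n$. Let $H_n=\sum_{k=1}^n \frac1k$ and $\sigma_n^2=\sum_{i=1}^n \frac{i-1}{i^2}$. Then $$\mathbf{E}(Q_n)=H_n\sim\log n,\qquad \operatorname{Var}(Q_n)=\sigma_n^2\sim\log n \qquad (n\to\infty),$$ and $Q_n$ is asymptotically normal: $$\frac{Q_n-H_n}{\sigma_n}\xrightarrow{d}\mathcal N(0,1)\qquad (n\to\infty).$$ -/

import Mathlib

open MeasureTheory ProbabilityTheory Filter Asymptotics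

namespace PermCycles

/-- The number of cycles of a permutation of a finite set. Fixed points count as cycles of length
one; `Equiv.Perm.cycleType` lists only the cycles of length at least two. -/
def numCycles {α : Type*} [Fintype α] [DecidableEq α] (σ : Equiv.Perm α) : ℕ :=
  Multiset.card σ.cycleType + (Finset.univ.filter fun a => σ a = a).card

/-- The finite set of permutations of `Fin n` carries the discrete sigma-algebra. -/
instance instMeasurableSpacePermFin (n : ℕ) : MeasurableSpace (Equiv.Perm (Fin n)) := ⊤

/-- The uniform distribution on the symmetric group on `n` letters. -/
noncomputable def uniformPerm (n : ℕ) : Measure (Equiv.Perm (Fin n)) :=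
  uniformOn Set.univ

/-- The sum of `(i - 1) / i ^ 2` over `1 ≤ i ≤ n`. -/
noncomputable def sigmaSq (n : ℕ) : ℝ :=
  ∑ i ∈ Finset.Icc 1 n, ((i : ℝ) - 1) / (i : ℝ) ^ 2

end PermCycles

namespace PermCycles

/-! ### Cycle counts under insertion of a letter. -/

section Combinatorics

open Equiv Equiv.Perm

variable {α : Type*} [Fintype α] [DecidableEq α]

/-! A permutation of `n + 1` letters arises uniquely from one of `n` letters by adding a new letter,
either as a fixed point (one way, one more cycle) or inside an existing cycle (`n` ways, same number
of cycles); `decomposeFin` is this bijection. Hence `Q_{n+1}` has the law of `Q_n` plus an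
independent Bernoulli variable of parameter `1/(n+1)`, which is the content of
`integral_numCycles_succ`. Applied to `k`, `k²` and a complex exponential, that recursion gives the
mean, the variance and a product formula for the centred characteristic function. Each factor of the
product is compared with a Gaussian one of equal variance. The total error is at most `2|s|³σ_n²`;
at `s = t/σ_n` it is `2|t|³/σ_n`, which tends to 0, and Lévy's continuity theorem concludes. -/

lemma numCycles_add_card_support (σ : Perm α) :
    numCycles σ + σ.support.card = Multiset.card σ.cycleType + Fintype.card α := by
  have h : (Finset.univ.filter fun a => σ a = a) = σ.supportᶜ := by ext; simp
  rw [numCycles, h, add_assoc, Finset.card_compl_add_card]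

/-- Inserting a fixed point into an existing cycle removes exactly one cycle. -/
lemma numCycles_swap_mul_of_apply_eq_self {g : Perm α} {a b : α} (hab : a ≠ b) (ha : g a = a) :
    numCycles (swap a b * g) + 1 = numCycles g := by
  have hh := numCycles_add_card_support (swap a b * g)
  have hg := numCycles_add_card_support g
  by_cases hb : g b = b
  · have hd : Disjoint (swap a b) g := by
      rw [disjoint_iff_eq_or_eq]
      intro x
      by_cases hxa : x = a
      · exact Or.inr (hxa ▸ ha)
      by_cases hxb : x = b
      · exact Or.inr (hxb ▸ hb)
      exact Or.inl (swap_apply_of_ne_of_ne hxa hxb)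
    rw [hd.cycleType_mul, hd.card_support_mul, card_support_swap hab, Multiset.card_add,
      card_cycleType_eq_one.2 (isCycle_swap hab)] at hh
    omega
  -- The cycle of `h` through `a` is the cycle of `g` through `b` with `a` inserted before `b`. It
  -- has length at least 3, so removing `a` again leaves a cycle; the remaining factor `d` is common
  -- to `g` and `h`. Thus `h` has as many nontrivial cycles as `g` and one more point in its
  -- support.
  · set h := swap a b * g with hdef
    have hha : h a = b := by simp [hdef, ha]
    have hgh : g = swap a b * h := by simp [hdef]
    have hgba : g b ≠ a := fun e => hab (g.injective (ha.trans e.symm))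
    have hhb : h b = g b := by
      rw [hdef, mul_apply, swap_apply_of_ne_of_ne hgba hb]
    have hne : h a ≠ a := by rw [hha]; exact hab.symm
    have hcyc : (h.cycleOf a).IsCycle := isCycle_cycleOf h hne
    have hca : h.cycleOf a a = b := by rw [cycleOf_apply_self, hha]
    have hcb : h.cycleOf a b = g b := by
      rw [← hhb, ← hha, cycleOf_apply_apply_self]
    have hcyc' : (swap a b * h.cycleOf a).IsCycle := by
      have := hcyc.swap_mul (x := a) (by rw [hca]; exact hab.symm) (by rw [hca, hcb]; exact hgba)
      rwa [hca] at this
    have hd : Disjoint (h * (h.cycleOf a)⁻¹) (h.cycleOf a) :=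
      disjoint_mul_inv_of_mem_cycleFactorsFinset
        (cycleOf_mem_cycleFactorsFinset_iff.2 (mem_support.2 hne))
    set d := h * (h.cycleOf a)⁻¹ with hddef
    have hhd : h = h.cycleOf a * d := by
      rw [hd.symm.commute.eq, hddef, inv_mul_cancel_right]
    have hd' : Disjoint (swap a b * h.cycleOf a) d := by
      intro x
      rcases hd x with hx | hx
      · exact Or.inr hx
      · left
        have hxa : x ≠ a := by rintro rfl; exact hab (hca ▸ hx).symm
        have hxb : x ≠ b := by rintro rfl; exact hb (hcb.symm.trans hx)
        rw [mul_apply, hx, swap_apply_of_ne_of_ne hxa hxb]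
    have hcard : Multiset.card h.cycleType = Multiset.card g.cycleType := by
      have hg' : g = (swap a b * h.cycleOf a) * d := by rw [mul_assoc, ← hhd, ← hgh]
      rw [hg', hd'.cycleType_mul, Multiset.card_add, card_cycleType_eq_one.2 hcyc']
      conv_lhs => rw [hhd, hd.symm.cycleType_mul, Multiset.card_add, card_cycleType_eq_one.2 hcyc]
    have hsupp : h.support = insert a g.support := by
      ext x
      by_cases hxa : x = a
      · simp [hxa, hne]
      · have hgx : g x ≠ a := fun e => hxa (g.injective (e.trans ha.symm))
        simp only [Finset.mem_insert, hxa, false_or, mem_support, not_iff_not]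
        rw [hdef, mul_apply, swap_apply_def, if_neg hgx]
        by_cases hgxb : g x = b
        · have hxb : x ≠ b := by rintro rfl; exact hb hgxb
          simp [hgxb, Ne.symm hxa, hxb.symm]
        · simp [hgxb]
    rw [hsupp, Finset.card_insert_of_notMem (by simp [ha]), hcard] at hh
    omega

lemma numCycles_decomposeFin_symm_zero {n : ℕ} (e : Perm (Fin n)) :
    numCycles (decomposeFin.symm (0, e)) = numCycles e + 1 := by
  have hext : decomposeFin.symm (0, e) = e.extendDomain (finSuccAboveEquiv (0 : Fin (n + 1))) := by
    ext x
    refine Fin.cases ?_ (fun i => ?_) x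
    · rw [decomposeFin_symm_apply_zero, extendDomain_apply_not_subtype _ _ (by simp)]
    · rw [decomposeFin_symm_apply_succ]
      have := extendDomain_apply_image e (finSuccAboveEquiv (0 : Fin (n + 1))) i
      simp only [finSuccAboveEquiv_apply, Fin.succAbove_zero] at this
      simp [this]
  have h1 := numCycles_add_card_support (decomposeFin.symm (0, e))
  have h2 := numCycles_add_card_support e
  rw [hext, cycleType_extendDomain, card_support_extend_domain, ← hext, Fintype.card_fin] at h1
  rw [Fintype.card_fin] at h2
  omega

lemma numCycles_decomposeFin_symm_succ {n : ℕ} (p : Fin n) (e : Perm (Fin n)) :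
    numCycles (decomposeFin.symm (p.succ, e)) = numCycles e := by
  have h : decomposeFin.symm (p.succ, e) = swap 0 p.succ * decomposeFin.symm (0, e) := by
    ext x
    refine Fin.cases ?_ (fun i => ?_) x <;> simp
  have h1 := numCycles_swap_mul_of_apply_eq_self (g := decomposeFin.symm (0, e))
    (Fin.succ_ne_zero p).symm (decomposeFin_symm_apply_zero 0 e)
  rw [← h, numCycles_decomposeFin_symm_zero] at h1
  omega

lemma sum_numCycles_succ {M : Type*} [AddCommMonoid M] (n : ℕ) (f : ℕ → M) :
    ∑ σ : Perm (Fin (n + 1)), f (numCycles σ) =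
      ∑ e : Perm (Fin n), f (numCycles e + 1) + n • ∑ e : Perm (Fin n), f (numCycles e) := by
  rw [← decomposeFin.symm.sum_comp, Fintype.sum_prod_type, Fin.sum_univ_succ]
  simp [numCycles_decomposeFin_symm_zero, numCycles_decomposeFin_symm_succ]

end Combinatorics

end PermCycles

/-! ### Mean, variance and their logarithmic growth. -/

namespace PermCycles

instance instDiscreteMeasurableSpacePermFin (n : ℕ) :
    DiscreteMeasurableSpace (Equiv.Perm (Fin n)) := ⟨fun _ => trivial⟩

instance instIsProbabilityMeasureUniformPerm (n : ℕ) : IsProbabilityMeasure (uniformPerm n) :=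
  inferInstanceAs (IsProbabilityMeasure (uniformOn Set.univ))

section Integral

variable {E : Type*} [NormedAddCommGroup E] [NormedSpace ℝ E] [CompleteSpace E]

lemma integral_uniformPerm (n : ℕ) (f : Equiv.Perm (Fin n) → E) :
    ∫ σ, f σ ∂uniformPerm n = (n.factorial : ℝ)⁻¹ • ∑ σ, f σ := by
  have h (σ : Equiv.Perm (Fin n)) : (uniformPerm n).real {σ} = (n.factorial : ℝ)⁻¹ := by
    rw [uniformPerm, measureReal_def, uniformOn_univ, Measure.count_singleton, Fintype.card_perm,
      Fintype.card_fin]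
    simp
  rw [integral_fintype Integrable.of_finite]
  simp_rw [h, ← Finset.smul_sum]

lemma integral_numCycles_succ (n : ℕ) (f : ℕ → E) :
    ∫ σ, f (numCycles σ) ∂uniformPerm (n + 1) =
      ((n : ℝ) + 1)⁻¹ • ∫ σ, f (numCycles σ + 1) ∂uniformPerm n +
        (n / ((n : ℝ) + 1)) • ∫ σ, f (numCycles σ) ∂uniformPerm n := by
  have h1 : (n : ℝ) + 1 ≠ 0 := by positivity
  have h2 : (n.factorial : ℝ) ≠ 0 := by positivity
  simp only [integral_uniformPerm]
  rw [sum_numCycles_succ, ← Nat.cast_smul_eq_nsmul ℝ, smul_add, Nat.factorial_succ]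
  simp only [smul_smul]
  push_cast
  congr 2 <;> field_simp

end Integral

lemma numCycles_fin_zero (σ : Equiv.Perm (Fin 0)) : numCycles σ = 0 := by
  have h := numCycles_add_card_support σ
  rw [Subsingleton.elim σ 1] at h ⊢
  simpa using h

lemma integral_numCycles (n : ℕ) :
    ∫ σ, (numCycles σ : ℝ) ∂uniformPerm n = (harmonic n : ℝ) := by
  induction n with
  | zero => simp [numCycles_fin_zero]
  | succ n ih =>
    have h1 : (n : ℝ) + 1 ≠ 0 := by positivity
    rw [integral_numCycles_succ n (fun k => (k : ℝ))]
    push_cast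
    rw [integral_add .of_finite .of_finite, ih, harmonic_succ]
    simp only [integral_const, probReal_univ, smul_eq_mul]
    push_cast
    field_simp
    ring

lemma sigmaSq_succ (n : ℕ) : sigmaSq (n + 1) = sigmaSq n + n / ((n : ℝ) + 1) ^ 2 := by
  rw [sigmaSq, Finset.sum_Icc_succ_top (by omega), ← sigmaSq]
  simp

lemma integral_numCycles_sq (n : ℕ) :
    ∫ σ, (numCycles σ : ℝ) ^ 2 ∂uniformPerm n = sigmaSq n + (harmonic n : ℝ) ^ 2 := by
  induction n with
  | zero => simp [numCycles_fin_zero, sigmaSq]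
  | succ n ih =>
    have h1 : (n : ℝ) + 1 ≠ 0 := by positivity
    have h3 : ∫ σ, ((numCycles σ : ℝ) + 1) ^ 2 ∂uniformPerm n =
        sigmaSq n + (harmonic n : ℝ) ^ 2 + 2 * (harmonic n : ℝ) + 1 := by
      simp_rw [add_sq, one_pow, mul_one]
      rw [integral_add .of_finite .of_finite, integral_add .of_finite .of_finite,
        integral_const_mul, ih, integral_numCycles]
      simp
    rw [integral_numCycles_succ n (fun k => (k : ℝ) ^ 2)]
    push_cast
    rw [h3, ih, harmonic_succ, sigmaSq_succ]
    push_cast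
    simp only [smul_eq_mul]
    field_simp
    ring

lemma variance_numCycles (n : ℕ) :
    variance (fun σ => (numCycles σ : ℝ)) (uniformPerm n) = sigmaSq n := by
  rw [variance_eq_sub MemLp.of_discrete]
  simp only [Pi.pow_apply]
  rw [integral_numCycles_sq, integral_numCycles]
  ring

lemma isEquivalent_harmonic_log :
    (fun n : ℕ => (harmonic n : ℝ)) ~[atTop] fun n : ℕ => Real.log n := by
  refine IsBigO.trans_isLittleO (g := fun _ : ℕ => (1 : ℝ)) ?_ ?_
  · exact Real.tendsto_harmonic_sub_log.isBigO_one ℝ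
  · exact (isLittleO_const_left.2 <| Or.inr <| tendsto_norm_atTop_atTop.comp <|
      Real.tendsto_log_atTop.comp tendsto_natCast_atTop_atTop)

/-- The subtracted sum converges, so `sigmaSq` inherits the asymptotics of the harmonic numbers. -/
lemma sigmaSq_eq (n : ℕ) :
    sigmaSq n = harmonic n - ∑ i ∈ Finset.range n, 1 / ((i : ℝ) + 1) ^ 2 := by
  induction n with
  | zero => simp [sigmaSq]
  | succ n ih =>
    have h1 : (n : ℝ) + 1 ≠ 0 := by positivity
    rw [sigmaSq_succ, ih, harmonic_succ, Finset.sum_range_succ]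
    push_cast
    field_simp
    ring

lemma isEquivalent_sigmaSq_log : sigmaSq ~[atTop] fun n : ℕ => Real.log n := by
  have hs : Summable fun i : ℕ => 1 / ((i : ℝ) + 1) ^ 2 := by
    have := (summable_nat_add_iff 1).2 (Real.summable_one_div_nat_pow.2 one_lt_two)
    exact_mod_cast this
  have heq : sigmaSq = (fun n : ℕ => (harmonic n : ℝ)) +
      fun n => -∑ i ∈ Finset.range n, 1 / ((i : ℝ) + 1) ^ 2 := by
    ext n
    simp only [sigmaSq_eq, Pi.add_apply, sub_eq_add_neg]
  rw [heq]
  refine isEquivalent_harmonic_log.add_isLittleO ?_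
  refine IsBigO.trans_isLittleO (g := fun _ : ℕ => (1 : ℝ)) ?_ ?_
  · exact hs.hasSum.tendsto_sum_nat.neg.isBigO_one ℝ
  · exact (isLittleO_const_left.2 <| Or.inr <| tendsto_norm_atTop_atTop.comp <|
      Real.tendsto_log_atTop.comp tendsto_natCast_atTop_atTop)

lemma tendsto_sigmaSq_atTop : Tendsto sigmaSq atTop atTop :=
  isEquivalent_sigmaSq_log.symm.tendsto_atTop <|
    Real.tendsto_log_atTop.comp tendsto_natCast_atTop_atTop

end PermCycles

/-! ### Characteristic functions and the Gaussian limit. -/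

namespace PermCycles

section CharFun

open Complex

/-- The characteristic function at `s` of a centred Bernoulli variable with parameter `p`. -/
noncomputable def centeredBernoulliCharFun (p s : ℝ) : ℂ :=
  (1 - p) * cexp ((-(s * p) : ℝ) * I) + p * cexp ((s * (1 - p) : ℝ) * I)

lemma norm_centeredBernoulliCharFun_le {p : ℝ} (h0 : 0 ≤ p) (h1 : p ≤ 1) (s : ℝ) :
    ‖centeredBernoulliCharFun p s‖ ≤ 1 := by
  refine (norm_add_le _ _).trans_eq ?_
  rw [norm_mul, norm_mul, norm_exp_ofReal_mul_I, norm_exp_ofReal_mul_I, ← ofReal_one, ← ofReal_sub,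
    norm_real, norm_real, Real.norm_of_nonneg h0, Real.norm_of_nonneg (sub_nonneg.2 h1)]
  ring

lemma norm_exp_mul_I_sub_quadratic_le {x : ℝ} (hx : |x| ≤ 1) :
    ‖cexp (x * I) - (1 + x * I - x ^ 2 / 2)‖ ≤ |x| ^ 3 := by
  have hn : ‖(x : ℂ) * I‖ = |x| := by simp
  have h := exp_bound (x := x * I) (hn.trans_le hx) (n := 3) (by norm_num)
  rw [hn] at h
  simp only [Finset.sum_range_succ, Finset.sum_range_zero] at h
  have he : (0 : ℂ) + (x * I) ^ 0 / (Nat.factorial 0 : ℕ) + (x * I) ^ 1 / (Nat.factorial 1 : ℕ) +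
      (x * I) ^ 2 / (Nat.factorial 2 : ℕ) = 1 + x * I - x ^ 2 / 2 := by
    simp [mul_pow, Nat.factorial]
    ring
  rw [he] at h
  refine h.trans (mul_le_of_le_one_right (by positivity) ?_)
  norm_num [Nat.factorial]

/-- Centring cancels the linear Taylor terms. Keeping the factor `p * (1 - p)` in the error matters:
summed over the parameters it gives exactly `sigmaSq`. -/
lemma norm_centeredBernoulliCharFun_sub_le {p s : ℝ} (h0 : 0 ≤ p) (h1 : p ≤ 1) (hs : |s| ≤ 1) :
    ‖centeredBernoulliCharFun p s - (1 - s ^ 2 / 2 * (p * (1 - p)) : ℝ)‖ ≤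
      |s| ^ 3 * (p * (1 - p)) := by
  have hq : 0 ≤ 1 - p := sub_nonneg.2 h1
  have ha : |(-(s * p))| = |s| * p := by rw [abs_neg, abs_mul, abs_of_nonneg h0]
  have hb : |s * (1 - p)| = |s| * (1 - p) := by rw [abs_mul, abs_of_nonneg hq]
  have e1 := norm_exp_mul_I_sub_quadratic_le (x := -(s * p))
    (by rw [ha]; exact mul_le_one₀ hs h0 h1)
  have e2 := norm_exp_mul_I_sub_quadratic_le (x := s * (1 - p))
    (by rw [hb]; exact mul_le_one₀ hs hq (by linarith))
  rw [ha] at e1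
  rw [hb] at e2
  set A := cexp ((-(s * p) : ℝ) * I) with hA
  set B := cexp ((s * (1 - p) : ℝ) * I) with hB
  have key : centeredBernoulliCharFun p s - (1 - s ^ 2 / 2 * (p * (1 - p)) : ℝ) =
      ((1 - p : ℝ) : ℂ) * (A - (1 + (-(s * p) : ℝ) * I - ((-(s * p) : ℝ) : ℂ) ^ 2 / 2)) +
      (p : ℂ) * (B - (1 + (s * (1 - p) : ℝ) * I - ((s * (1 - p) : ℝ) : ℂ) ^ 2 / 2)) := by
    rw [centeredBernoulliCharFun, ← hA, ← hB]
    push_cast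
    ring
  rw [key]
  refine (norm_add_le _ _).trans ?_
  rw [norm_mul, norm_mul, norm_real, norm_real, Real.norm_of_nonneg h0, Real.norm_of_nonneg hq]
  calc (1 - p) * _ + p * _ ≤ (1 - p) * (|s| * p) ^ 3 + p * (|s| * (1 - p)) ^ 3 := by gcongr
    _ = |s| ^ 3 * (p * (1 - p)) * (p ^ 2 + (1 - p) ^ 2) := by ring
    _ ≤ |s| ^ 3 * (p * (1 - p)) := by
      refine mul_le_of_le_one_right (by positivity) ?_
      nlinarith

lemma norm_centeredBernoulliCharFun_sub_exp_le {p s : ℝ} (h0 : 0 ≤ p) (h1 : p ≤ 1)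
    (hs : |s| ≤ 1) :
    ‖centeredBernoulliCharFun p s - (Real.exp (-(s ^ 2 / 2 * (p * (1 - p)))) : ℝ)‖ ≤
      2 * |s| ^ 3 * (p * (1 - p)) := by
  have hq : 0 ≤ 1 - p := sub_nonneg.2 h1
  set v := p * (1 - p) with hv
  have hv0 : 0 ≤ v := mul_nonneg h0 hq
  have hv1 : v ≤ 1 := mul_le_one₀ h1 hq (by linarith)
  have hs2 : s ^ 2 ≤ 1 := by rw [← sq_abs]; exact pow_le_one₀ (abs_nonneg _) hs
  have hx0 : 0 ≤ s ^ 2 / 2 * v := by positivity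
  have hx1 : s ^ 2 / 2 * v ≤ 1 := mul_le_one₀ (by linarith) hv0 hv1
  have e := Real.norm_exp_sub_one_sub_id_le (x := -(s ^ 2 / 2 * v))
    (by rwa [norm_neg, Real.norm_of_nonneg hx0])
  rw [norm_neg, Real.norm_of_nonneg hx0] at e
  have e' : ‖((1 - s ^ 2 / 2 * v : ℝ) : ℂ) - (Real.exp (-(s ^ 2 / 2 * v)) : ℝ)‖ ≤
      |s| ^ 3 * v := by
    rw [← ofReal_sub, norm_real, norm_sub_rev]
    calc _ = ‖Real.exp (-(s ^ 2 / 2 * v)) - 1 - -(s ^ 2 / 2 * v)‖ := by congr 1; ring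
      _ ≤ (s ^ 2 / 2 * v) ^ 2 := e
      _ = |s| ^ 3 * v * (|s| * v / 4) := by rw [← sq_abs s]; ring
      _ ≤ |s| ^ 3 * v := by
        refine mul_le_of_le_one_right (by positivity) ?_
        nlinarith [mul_le_one₀ hs hv0 hv1]
  calc _ ≤ _ := norm_sub_le_norm_sub_add_norm_sub _ ((1 - s ^ 2 / 2 * v : ℝ) : ℂ) _
    _ ≤ |s| ^ 3 * v + |s| ^ 3 * v := add_le_add (norm_centeredBernoulliCharFun_sub_le h0 h1 hs) e'
    _ = _ := by ring

/-- Telescoping: factors are exchanged one at a time, and the others have norm at most 1. -/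
lemma norm_prod_range_sub_prod_range_le {a b : ℕ → ℂ} (ha : ∀ k, ‖a k‖ ≤ 1) (hb : ∀ k, ‖b k‖ ≤ 1)
    (n : ℕ) : ‖∏ k ∈ Finset.range n, a k - ∏ k ∈ Finset.range n, b k‖ ≤
      ∑ k ∈ Finset.range n, ‖a k - b k‖ := by
  induction n with
  | zero => simp
  | succ n ih =>
    rw [Finset.prod_range_succ, Finset.prod_range_succ, Finset.sum_range_succ]
    have hB : ‖∏ k ∈ Finset.range n, b k‖ ≤ 1 := by
      rw [norm_prod]
      exact Finset.prod_le_one (fun _ _ => norm_nonneg _) fun k _ => hb k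
    calc _ = ‖(∏ k ∈ Finset.range n, a k - ∏ k ∈ Finset.range n, b k) * a n +
          (∏ k ∈ Finset.range n, b k) * (a n - b n)‖ := by congr 1; ring
      _ ≤ ‖∏ k ∈ Finset.range n, a k - ∏ k ∈ Finset.range n, b k‖ * ‖a n‖ +
          ‖∏ k ∈ Finset.range n, b k‖ * ‖a n - b n‖ := by
        rw [← norm_mul, ← norm_mul]; exact norm_add_le _ _
      _ ≤ _ := add_le_add ((mul_le_of_le_one_right (norm_nonneg _) (ha n)).trans ih)
          (mul_le_of_le_one_left (norm_nonneg _) hB)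

lemma sigmaSq_eq_sum_range (n : ℕ) :
    sigmaSq n = ∑ k ∈ Finset.range n, ((k : ℝ) + 1)⁻¹ * (1 - ((k : ℝ) + 1)⁻¹) := by
  induction n with
  | zero => simp [sigmaSq]
  | succ n ih =>
    have h1 : (n : ℝ) + 1 ≠ 0 := by positivity
    rw [sigmaSq_succ, ih, Finset.sum_range_succ]
    field_simp
    ring

/-- Feller's product formula: the number of cycles has the characteristic function of a sum of
independent Bernoulli variables with parameters `1 / k`. -/
lemma integral_exp_numCycles_sub_harmonic (n : ℕ) (s : ℝ) :
    ∫ σ, cexp ((s * ((numCycles σ : ℝ) - (harmonic n : ℝ)) : ℝ) * I) ∂uniformPerm n =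
      ∏ k ∈ Finset.range n, centeredBernoulliCharFun ((k : ℝ) + 1)⁻¹ s := by
  induction n with
  | zero => simp [numCycles_fin_zero]
  | succ n ih =>
    have h1 : (n : ℂ) + 1 ≠ 0 := by exact_mod_cast n.succ_ne_zero
    rw [integral_numCycles_succ n
      (fun k => cexp ((s * ((k : ℝ) - (harmonic (n + 1) : ℝ)) : ℝ) * I)), Finset.prod_range_succ,
      ← ih]
    set p : ℝ := ((n : ℝ) + 1)⁻¹ with hp
    have hH : (harmonic (n + 1) : ℝ) = harmonic n + p := by rw [harmonic_succ]; push_cast; rfl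
    have e1 (k : ℕ) : cexp ((s * (((k + 1 : ℕ) : ℝ) - (harmonic (n + 1) : ℝ)) : ℝ) * I) =
        cexp ((s * ((k : ℝ) - (harmonic n : ℝ)) : ℝ) * I) * cexp ((s * (1 - p) : ℝ) * I) := by
      rw [← Complex.exp_add, hH]
      congr 1
      push_cast
      ring
    have e2 (k : ℕ) : cexp ((s * ((k : ℝ) - (harmonic (n + 1) : ℝ)) : ℝ) * I) =
        cexp ((s * ((k : ℝ) - (harmonic n : ℝ)) : ℝ) * I) * cexp ((-(s * p) : ℝ) * I) := by
      rw [← Complex.exp_add, hH]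
      congr 1
      push_cast
      ring
    have hq : (n : ℝ) / (n + 1) = 1 - p := by rw [hp]; field_simp; ring
    simp_rw [e1, e2, hq]
    rw [integral_mul_const, integral_mul_const, centeredBernoulliCharFun, real_smul, real_smul]
    push_cast
    ring

lemma norm_prod_centeredBernoulliCharFun_sub_le (n : ℕ) {s : ℝ} (hs : |s| ≤ 1) :
    ‖∏ k ∈ Finset.range n, centeredBernoulliCharFun ((k : ℝ) + 1)⁻¹ s -
      (Real.exp (-(s ^ 2 / 2 * sigmaSq n)) : ℝ)‖ ≤ 2 * |s| ^ 3 * sigmaSq n := by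
  have h0 (k : ℕ) : 0 ≤ ((k : ℝ) + 1)⁻¹ := by positivity
  have h1 (k : ℕ) : ((k : ℝ) + 1)⁻¹ ≤ 1 := inv_le_one_of_one_le₀ (by simp)
  have hexp : ((Real.exp (-(s ^ 2 / 2 * sigmaSq n)) : ℝ) : ℂ) = ∏ k ∈ Finset.range n,
      ((Real.exp (-(s ^ 2 / 2 * (((k : ℝ) + 1)⁻¹ * (1 - ((k : ℝ) + 1)⁻¹)))) : ℝ) : ℂ) := by
    rw [← ofReal_prod, ← Real.exp_sum, Finset.sum_neg_distrib, ← Finset.mul_sum,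
      sigmaSq_eq_sum_range]
  rw [hexp]
  refine (norm_prod_range_sub_prod_range_le
    (fun k => norm_centeredBernoulliCharFun_le (h0 k) (h1 k) s) (fun k => ?_) n).trans ?_
  · rw [norm_real, Real.norm_of_nonneg (Real.exp_pos _).le, Real.exp_le_one_iff, neg_nonpos]
    have := mul_nonneg (h0 k) (sub_nonneg.2 (h1 k))
    positivity
  · rw [sigmaSq_eq_sum_range, Finset.mul_sum]
    exact Finset.sum_le_sum fun k _ => norm_centeredBernoulliCharFun_sub_exp_le (h0 k) (h1 k) hs

lemma tendsto_charFun_numCycles (t : ℝ) :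
    Tendsto (fun n : ℕ => ∫ σ, cexp ((t * (((numCycles σ : ℝ) - (harmonic n : ℝ)) /
      √(sigmaSq n)) : ℝ) * I) ∂uniformPerm n) atTop (nhds (cexp (-(t ^ 2 / 2)))) := by
  have hσ : Tendsto (fun n => √(sigmaSq n)) atTop atTop :=
    Real.tendsto_sqrt_atTop.comp tendsto_sigmaSq_atTop
  rw [tendsto_iff_norm_sub_tendsto_zero]
  refine squeeze_zero' (g := fun n => 2 * |t| ^ 3 / √(sigmaSq n))
    (Eventually.of_forall fun _ => norm_nonneg _) ?_ (hσ.const_div_atTop _)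
  -- The bound `|t| + 1` secures both `r > 0` and `|t / r| ≤ 1`.
  filter_upwards [hσ.eventually_ge_atTop (|t| + 1)] with n hn
  set r := √(sigmaSq n) with hr
  have hr0 : 0 < r := by have := abs_nonneg t; linarith
  have hr2 : r ^ 2 = sigmaSq n := Real.sq_sqrt (Real.sqrt_pos.1 hr0).le
  have hs : |t / r| ≤ 1 := by
    rw [abs_div, abs_of_pos hr0, div_le_one hr0]
    linarith
  have h := norm_prod_centeredBernoulliCharFun_sub_le n hs
  rw [← integral_exp_numCycles_sub_harmonic, ← hr2, abs_div, abs_of_pos hr0] at h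
  have e1 (x : ℝ) : t / r * x = t * (x / r) := by ring
  have e2 : (t / r) ^ 2 / 2 * r ^ 2 = t ^ 2 / 2 := by field_simp
  have e3 : 2 * (|t| / r) ^ 3 * r ^ 2 = 2 * |t| ^ 3 / r := by field_simp
  simp_rw [e1] at h
  rw [e2, e3] at h
  exact_mod_cast h

end CharFun

end PermCycles

theorem mainTheorem7 {Ω : ℕ → Type*} [∀ n, MeasurableSpace (Ω n)]
    (P : (n : ℕ) → Measure (Ω n)) [∀ n, IsProbabilityMeasure (P n)]
    (π : (n : ℕ) → Ω n → Equiv.Perm (Fin n))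
    (hπ : ∀ n, HasLaw (π n) (PermCycles.uniformPerm n) (P n)) :
    (∀ n, ∫ ω, (PermCycles.numCycles (π n ω) : ℝ) ∂(P n) = (harmonic n : ℝ)) ∧
    (fun n : ℕ => ∫ ω, (PermCycles.numCycles (π n ω) : ℝ) ∂(P n))
      ~[atTop] (fun n : ℕ => Real.log n) ∧
    (∀ n, variance (fun ω => (PermCycles.numCycles (π n ω) : ℝ)) (P n) = PermCycles.sigmaSq n) ∧
    PermCycles.sigmaSq ~[atTop] (fun n : ℕ => Real.log n) ∧
    TendstoInDistribution
      (fun (n : ℕ) (ω : Ω n) =>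
        ((PermCycles.numCycles (π n ω) : ℝ) - (harmonic n : ℝ)) / √(PermCycles.sigmaSq n))
      atTop (id : ℝ → ℝ) P (gaussianReal 0 1) := by
  have hmean (n : ℕ) : ∫ ω, (PermCycles.numCycles (π n ω) : ℝ) ∂(P n) = (harmonic n : ℝ) := by
    rw [← PermCycles.integral_numCycles]
    exact (hπ n).integral_comp (f := fun σ => (PermCycles.numCycles σ : ℝ))
      AEStronglyMeasurable.of_discrete
  have hmeas (n : ℕ) : AEMeasurable (fun ω => ((PermCycles.numCycles (π n ω) : ℝ) -
      (harmonic n : ℝ)) / √(PermCycles.sigmaSq n)) (P n) :=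
    (Measurable.of_discrete (f := fun σ : Equiv.Perm (Fin n) =>
      ((PermCycles.numCycles σ : ℝ) - (harmonic n : ℝ)) / √(PermCycles.sigmaSq n))).comp_aemeasurable
      (hπ n).aemeasurable
  refine ⟨hmean, ?_, fun n => ?_, PermCycles.isEquivalent_sigmaSq_log, hmeas, aemeasurable_id, ?_⟩
  · simp_rw [hmean]
    exact PermCycles.isEquivalent_harmonic_log
  · rw [← PermCycles.variance_numCycles, ← (hπ n).map_eq,
      variance_map (Measurable.of_discrete.aemeasurable) (hπ n).aemeasurable]
    rfl
  · refine ProbabilityMeasure.tendsto_iff_tendsto_charFun.2 fun t => ?_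
    simp only [ProbabilityMeasure.coe_mk, Measure.map_id, charFun_gaussianReal]
    have hlim : Complex.exp (t * (0 : ℝ) * Complex.I - ((1 : NNReal) : ℝ) * t ^ 2 / 2) =
        Complex.exp (-(t ^ 2 / 2)) := by
      congr 1; simp
    rw [hlim]
    refine (PermCycles.tendsto_charFun_numCycles t).congr fun n => ?_
    rw [charFun_apply_real, integral_map (hmeas n) (by fun_prop), ← (hπ n).integral_comp
      AEStronglyMeasurable.of_discrete]
    simp
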